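/- Let $r\ge 0$ and let $P_1,\ldots,P_r\subset\mathbb{R}^n$ be nonempty convex polytopes (convex hulls of finite sets of points, not necessarily full-dimensional), and let $P=P_1+\cdots+P_r$ be their Minkowski sum (for $r=0$, $P=\{0\}$). A face of a polytope is the set of its points at which some linear functional attains its maximum over the polytope (the polytope itself is thus a face), and a facet of $P$ is a face of dimension $\dim P-1$. Every nonempty face $F$ of $P$ has a unique decomposition $F=F_1+\cdots+F_r$ with $F_i$ a nonempty face of $P_i$; it is called exact if $\dim F=\dim F_1+\cdots+\dim F_r$. Assume that $P_1,\ldots,P_r$ are relatively in general position, that is, every facet of $P$ has an exact decomposition. Let $d=\dim P$, let $f_k(Q)$ denote the number of $k$-dimensional faces of a polytope $Q$ ($Q$ itself being counted when $k=\dim Q$), and put $$ f^\delta_k(P)=f_k(P)-\bigl(f_k(P_1)+\cdots+f_k(P_r)\bigr). $$ Let $S\subseteq\{1,\ldots,r\}$ be the set of indices $i$ for which $\dim(P_i)<d$. Then $$ \sum_{k=0}^{d-1}(-1)^k\, k\, f^\delta_k(P) = (-1)^{d+1}\sum_{i\in S}\dim(P_i). $$ -/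

import Mathlib

open scoped Pointwise

noncomputable section

namespace MinkowskiFaces

variable {E : Type*} [NormedAddCommGroup E] [NormedSpace ℝ E]

/-- A (nonempty convex) polytope: the convex hull of a finite nonempty set of points. -/
def IsPolytope (P : Set E) : Prop :=
  ∃ s : Finset E, s.Nonempty ∧ P = convexHull ℝ (s : Set E)

/-- The dimension of a nonempty set: the dimension of its affine hull. -/
def dim (F : Set E) : ℕ :=
  Module.finrank ℝ (vectorSpan ℝ F)

/-- `F` is a nonempty face of `P`: the nonempty set of all points of `P` at which some linear
functional attains its maximum over `P`. The zero functional gives `P` itself. -/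
def IsFace (F P : Set E) : Prop :=
  F.Nonempty ∧ IsExposed ℝ P F

/-- `F` is a facet of `P`: a face of dimension `dim P - 1`. -/
def IsFacet (F P : Set E) : Prop :=
  IsFace F P ∧ dim F + 1 = dim P

/-- `f_k(P)`, the number of faces of `P` of dimension `k` (for `k ≥ 0`, so all of these faces are
nonempty; `P` itself is counted when `k = dim P`). -/
def fVec (k : ℕ) (P : Set E) : ℕ :=
  {F : Set E | IsFace F P ∧ dim F = k}.ncard

/-- The faces `G i` of the summands `P i` form a decomposition of `F`: `F = G_1 + ⋯ + G_r`. -/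
def IsDecomposition {r : ℕ} (P : Fin r → Set E) (F : Set E) (G : Fin r → Set E) : Prop :=
  (∀ i, IsFace (G i) (P i)) ∧ F = ∑ i, G i

/-- The summands `P i` are relatively in general position: every facet of their Minkowski sum has
an exact decomposition, that is, one in which the dimensions add up. -/
def RelativelyInGeneralPosition {r : ℕ} (P : Fin r → Set E) : Prop :=
  ∀ F : Set E, IsFacet F (∑ i, P i) →
    ∃ G : Fin r → Set E, IsDecomposition P F G ∧ dim F = ∑ i, dim (G i)

/-- `f^δ_k(F) = f_k(F) - (f_k(F_1) + ⋯ + f_k(F_r))` for a face `F = F_1 + ⋯ + F_r` of a Minkowski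
sum with decomposition `F_1, …, F_r`. The whole sum `P_1 + ⋯ + P_r` has the decomposition
`P_1, …, P_r`. -/
def fDelta {r : ℕ} (k : ℕ) (F : Fin r → Set E) : ℤ :=
  (fVec k (∑ i, F i) : ℤ) - ∑ i, (fVec k (F i) : ℤ)

end MinkowskiFaces

end

/-! Every face of `P` is `maxFace u P` for some functional `u`, and its `i`-th summand is `maxFace u
(P i)`. Fix a face `G` of `P i`. The functionals whose maximal face on `P i` is `G` form a
relatively open convex cone of dimension `n - dim G`. It is partitioned by the cones of the faces
`F` of `P` whose `i`-th summand is `G`. The Euler characteristic is additive on such partitions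
(`euler_relation`), so `∑ (-1)^dim F = (-1)^dim G` over these `F` (`sum_faces_lying_over`).

General position gives `dim F = ∑ i, dim F_i` for facets. It extends to every proper face, since
each lies in a facet (`IsPolytope.exists_facet`) and independence of direction spaces passes to
subspaces. Hence the sum of `(-1)^dim F * dim F` over proper faces splits over `i`. Grouping faces
by their `i`-th summand `G` turns the `i`-th part into the sum of `(-1)^dim G * dim G` over all
faces of `P i`, minus the contribution `(-1)^d * dim (P i)` of `F = P`.

The range `k < d` omits `P i` from its own face count exactly when `dim (P i) = d`; the other
indices leave the stated right-hand side. -/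

namespace MinkowskiFaces

/-! ### Euler characteristic of relatively open convex sets -/

section EulerRelation

open Filter Topology

/-- A convex set which is open in its affine span, in the algebraic sense that every segment in
the set can be extended beyond its endpoints. -/
def RelOpenConvex {V : Type*} [AddCommGroup V] [Module ℝ V] (A : Set V) : Prop :=
  Convex ℝ A ∧ ∀ x ∈ A, ∀ y ∈ A, ∃ ε : ℝ, 0 < ε ∧ x + ε • (x - y) ∈ A

open Classical in
/-- The integer-valued indicator of a set. -/
noncomputable def ind {V : Type*} (A : Set V) (x : V) : ℤ := if x ∈ A then 1 else 0

theorem ind_of_mem {V : Type*} {A : Set V} {x : V} (h : x ∈ A) : ind A x = 1 := if_pos h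

theorem ind_of_notMem {V : Type*} {A : Set V} {x : V} (h : x ∉ A) : ind A x = 0 := if_neg h

theorem ind_congr {V W : Type*} {A : Set V} {B : Set W} {x : V} {y : W} (h : x ∈ A ↔ y ∈ B) :
    ind A x = ind B y := by
  by_cases hx : x ∈ A
  · rw [ind_of_mem hx, ind_of_mem (h.1 hx)]
  · rw [ind_of_notMem hx, ind_of_notMem (mt h.2 hx)]

namespace RelOpenConvex

variable {V W : Type*} [AddCommGroup V] [Module ℝ V] [AddCommGroup W] [Module ℝ W] {A : Set V}

theorem add_smul_mem (hA : RelOpenConvex A) {x v : V} {ε δ : ℝ} (hx : x ∈ A) (hδ : 0 ≤ δ)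
    (h : δ ≤ ε) (hv : x + ε • v ∈ A) : x + δ • v ∈ A := by
  rcases hδ.eq_or_lt with rfl | hδ
  · simpa using hx
  have hε : 0 < ε := hδ.trans_le h
  have := hA.1.add_smul_mem hx hv (t := δ / ε) ⟨by positivity, (div_le_one hε).2 h⟩
  rwa [smul_smul, div_mul_cancel₀ _ hε.ne'] at this

/-- The directions in which one can move from a point of a relatively open convex set are exactly
the vectors parallel to its affine span. -/
theorem mem_vectorSpan_iff (hA : RelOpenConvex A) {x : V} (hx : x ∈ A) (v : V) :
    v ∈ vectorSpan ℝ A ↔ ∃ ε : ℝ, 0 < ε ∧ x + ε • v ∈ A := by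
  constructor
  · intro hv
    rw [vectorSpan_eq_span_vsub_set_right ℝ hx] at hv
    -- The feasible directions at `x` already form a subspace: midpoints give sums, and extending
    -- segments beyond `x` gives negatives.
    let S : Submodule ℝ V :=
      { carrier := {v | ∃ ε : ℝ, 0 < ε ∧ x + ε • v ∈ A}
        zero_mem' := ⟨1, one_pos, by simpa using hx⟩
        add_mem' := by
          rintro a b ⟨ε, hε, ha⟩ ⟨δ, hδ, hb⟩
          refine ⟨min ε δ / 2, by positivity, ?_⟩
          have h1 := hA.add_smul_mem hx (le_of_lt (lt_min hε hδ)) (min_le_left _ _) ha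
          have h2 := hA.add_smul_mem hx (le_of_lt (lt_min hε hδ)) (min_le_right _ _) hb
          have := hA.1 h1 h2 (by norm_num : (0 : ℝ) ≤ 1 / 2) (by norm_num : (0 : ℝ) ≤ 1 / 2)
            (by norm_num)
          convert this using 1
          module
        smul_mem' := by
          rintro c a ⟨ε, hε, ha⟩
          rcases lt_trichotomy c 0 with hc | rfl | hc
          · obtain ⟨δ, hδ, h⟩ := hA.2 x hx _ ha
            refine ⟨δ * ε / (-c), div_pos (mul_pos hδ hε) (neg_pos.2 hc), ?_⟩
            convert h using 1
            rw [smul_smul, div_mul_eq_mul_div, mul_div_assoc, div_neg, div_self hc.ne]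
            module
          · exact ⟨1, one_pos, by simpa using hx⟩
          · refine ⟨ε / c, div_pos hε hc, ?_⟩
            rwa [smul_smul, div_mul_cancel₀ _ hc.ne'] }
    have hS : Submodule.span ℝ ((· -ᵥ x) '' A) ≤ S := by
      rw [Submodule.span_le]
      rintro _ ⟨y, hy, rfl⟩
      exact ⟨1, one_pos, by simpa using hy⟩
    exact hS hv
  · rintro ⟨ε, hε, h⟩
    have := vsub_mem_vectorSpan ℝ h hx
    simp only [vsub_eq_sub, add_sub_cancel_left] at this
    exact (Submodule.smul_mem_iff _ hε.ne').1 this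

theorem image (hA : RelOpenConvex A) (f : V →ₗ[ℝ] W) : RelOpenConvex (f '' A) := by
  refine ⟨hA.1.linear_image f, ?_⟩
  rintro _ ⟨x, hx, rfl⟩ _ ⟨y, hy, rfl⟩
  obtain ⟨ε, hε, h⟩ := hA.2 x hx y hy
  exact ⟨ε, hε, _, h, by simp⟩

theorem slice (hA : RelOpenConvex A) (f : V →ₗ[ℝ] ℝ) (t : ℝ) :
    RelOpenConvex (A ∩ {x | f x = t}) := by
  refine ⟨hA.1.inter ?_, ?_⟩
  · exact convex_hyperplane f.isLinear t
  · rintro x ⟨hx, hxt⟩ y ⟨hy, hyt⟩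
    obtain ⟨ε, hε, h⟩ := hA.2 x hx y hy
    refine ⟨ε, hε, h, ?_⟩
    simp only [Set.mem_ofPred_eq] at hxt hyt ⊢
    simp [hxt, hyt]

theorem vectorSpan_slice (hA : RelOpenConvex A) (f : V →ₗ[ℝ] ℝ) {t : ℝ}
    (ht : (A ∩ {x | f x = t}).Nonempty) :
    vectorSpan ℝ (A ∩ {x | f x = t}) = vectorSpan ℝ A ⊓ LinearMap.ker f := by
  obtain ⟨x, hx⟩ := ht
  ext v
  rw [Submodule.mem_inf, (hA.slice f t).mem_vectorSpan_iff hx, hA.mem_vectorSpan_iff hx.1]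
  constructor
  · rintro ⟨ε, hε, h, h'⟩
    refine ⟨⟨ε, hε, h⟩, ?_⟩
    have hxt : f x = t := hx.2
    have h'' : f (x + ε • v) = t := h'
    rw [map_add, map_smul, hxt, smul_eq_mul] at h''
    have : ε * f v = 0 := by linarith
    exact (mul_eq_zero.1 this).resolve_left hε.ne'
  · rintro ⟨⟨ε, hε, h⟩, h'⟩
    refine ⟨ε, hε, h, ?_⟩
    have hxt : f x = t := hx.2
    simp [hxt, LinearMap.mem_ker.1 h']

theorem vectorSpan_linear_image (A : Set V) (f : V →ₗ[ℝ] W) :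
    vectorSpan ℝ (f '' A) = (vectorSpan ℝ A).map f :=
  f.toAffineMap.map_vectorSpan.symm

theorem finrank_eq_add [FiniteDimensional ℝ V] (U : Submodule ℝ V) (f : V →ₗ[ℝ] W) :
    Module.finrank ℝ U =
      Module.finrank ℝ ↥(U ⊓ LinearMap.ker f) + Module.finrank ℝ (U.map f) := by
  have h := (f.domRestrict U).finrank_range_add_finrank_ker
  have hk : LinearMap.ker (f.domRestrict U) = (U ⊓ LinearMap.ker f).comap U.subtype := by
    ext x
    simp
  rw [LinearMap.range_domRestrict, hk,
    (Submodule.comapSubtypeEquivOfLe inf_le_left).finrank_eq] at h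
  omega

/-- A relatively open convex subset of the line is a point or open. -/
theorem eq_singleton_or_isOpen {B : Set ℝ} (hB : RelOpenConvex B) (hne : B.Nonempty) :
    (∃ a, B = {a} ∧ Module.finrank ℝ (vectorSpan ℝ B) = 0) ∨
      IsOpen B ∧ Module.finrank ℝ (vectorSpan ℝ B) = 1 := by
  obtain ⟨a, ha⟩ := hne
  by_cases h : vectorSpan ℝ B = ⊥
  · left
    refine ⟨a, ?_, by rw [h]; exact finrank_bot ℝ ℝ⟩
    ext b
    refine ⟨fun hb => ?_, fun hb => by rw [hb]; exact ha⟩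
    have := vsub_mem_vectorSpan ℝ hb ha
    rw [h, Submodule.mem_bot] at this
    simpa [sub_eq_zero] using this
  · right
    have htop : vectorSpan ℝ B = ⊤ := (eq_bot_or_eq_top _).resolve_left h
    refine ⟨?_, by rw [htop]; simp⟩
    rw [isOpen_iff_mem_nhds]
    intro x hx
    obtain ⟨ε, hε, h1⟩ := (hB.mem_vectorSpan_iff hx 1).1 (by simp [htop])
    obtain ⟨δ, hδ, h2⟩ := (hB.mem_vectorSpan_iff hx (-1)).1 (by simp [htop])
    refine mem_of_superset (Icc_mem_nhds (a := x + δ • (-1)) (b := x + ε • 1) ?_ ?_)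
      (hB.1.ordConnected.out h2 h1)
    · simpa using hδ
    · simpa using hε

end RelOpenConvex

/-- An open interval does not jump to the right of a point other than its left endpoint. -/
theorem eventually_mem_iff_add_mem {B : Set ℝ} (hB : B.OrdConnected) (ho : IsOpen B)
    {t : ℝ} (ht : BddBelow B → t ≠ sInf B) : ∀ᶠ ε in 𝓝[>] (0 : ℝ), (t ∈ B ↔ t + ε ∈ B) := by
  have hlim : Tendsto (fun ε : ℝ => t + ε) (𝓝[>] 0) (𝓝 t) := by
    have : Tendsto (fun ε : ℝ => t + ε) (𝓝 0) (𝓝 (t + 0)) :=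
      (continuous_const.add continuous_id).tendsto 0
    rw [add_zero] at this
    exact this.mono_left nhdsWithin_le_nhds
  by_cases htB : t ∈ B
  · filter_upwards [hlim.eventually (ho.mem_nhds htB)] with ε hε
    exact ⟨fun _ => hε, fun _ => htB⟩
  by_cases hb : ∃ b ∈ B, b < t
  · obtain ⟨b, hb, hbt⟩ := hb
    filter_upwards [self_mem_nhdsWithin] with ε hε
    refine ⟨fun h => absurd h htB, fun h => hB.out hb h ⟨hbt.le, ?_⟩⟩
    have : 0 < ε := hε
    linarith
  · push Not at hb
    have hlt : t < sInf B ∨ B = ∅ := by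
      rcases B.eq_empty_or_nonempty with h | h
      · exact Or.inr h
      · exact Or.inl (lt_of_le_of_ne (le_csInf h hb) (ht ⟨t, hb⟩))
    rcases hlt with hlt | rfl
    · filter_upwards [hlim.eventually (eventually_lt_nhds hlt)] with ε hε
      exact ⟨fun h => absurd h htB, fun h => absurd (csInf_le ⟨t, hb⟩ h) (not_le.2 hε)⟩
    · simp

/-- The Euler characteristic of a relatively open convex subset of the line, computed by summing
the jumps to the right and the value at minus infinity. -/
theorem RelOpenConvex.exists_jump_sum {B : Set ℝ} (hB : RelOpenConvex B) (hne : B.Nonempty) :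
    ∃ T₀ : Finset ℝ, ∀ T : Finset ℝ, T₀ ⊆ T → ∀ᶠ p in (𝓝[>] (0 : ℝ)) ×ˢ (atBot : Filter ℝ),
      ∑ t ∈ T, (ind B t - ind B (t + p.1)) - ind B p.2 =
        (-1) ^ Module.finrank ℝ (vectorSpan ℝ B) := by
  rcases hB.eq_singleton_or_isOpen hne with ⟨a, rfl, hr⟩ | ⟨ho, hr⟩
  · refine ⟨{a}, fun T hT => ?_⟩
    have h1 : ∀ᶠ ε in 𝓝[>] (0 : ℝ), ∀ t ∈ T, t + ε ≠ a := by
      rw [eventually_all_finset]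
      intro t _
      rcases le_or_gt a t with h | h
      · filter_upwards [self_mem_nhdsWithin] with ε hε
        have : 0 < ε := hε
        linarith
      · have : ∀ᶠ ε in 𝓝 (0 : ℝ), ε < a - t := eventually_lt_nhds (by linarith)
        filter_upwards [this.filter_mono nhdsWithin_le_nhds] with ε hε
        linarith
    filter_upwards [h1.prod_mk (eventually_lt_atBot a)] with p hp
    rw [hr, ind_of_notMem (x := p.2) (by simpa using hp.2.ne), Finset.sum_eq_single a]
    · rw [ind_of_mem (Set.mem_singleton a), ind_of_notMem (by simpa using hp.1 a (hT (by simp)))]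
      simp
    · intro t ht hta
      rw [ind_of_notMem (by simpa using hta), ind_of_notMem (by simpa using hp.1 t ht), sub_zero]
    · intro h
      exact absurd (hT (by simp)) h
  · have hconn := hB.1.ordConnected
    -- An open interval contributes -1 through the jump at its left endpoint or, if it has none,
    -- through its value near minus infinity. Its right endpoint gives no jump to the right.
    by_cases hb : BddBelow B
    · refine ⟨{sInf B}, fun T hT => ?_⟩
      have hinf : sInf B ∉ B := fun h => by
        obtain ⟨l, u, ⟨hl, hu⟩, hsub⟩ := mem_nhds_iff_exists_Ioo_subset.1 (ho.mem_nhds h)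
        have h2 := hsub ⟨(by linarith : l < (l + sInf B) / 2), by linarith⟩
        linarith [csInf_le hb h2]
      have h1 : ∀ᶠ ε in 𝓝[>] (0 : ℝ), ∀ t ∈ T, t ≠ sInf B → (t ∈ B ↔ t + ε ∈ B) := by
        rw [eventually_all_finset]
        intro t _
        by_cases h : t = sInf B
        · simp [h]
        · filter_upwards [eventually_mem_iff_add_mem hconn ho fun _ => h] with ε hε _
          exact hε
      have h2 : ∀ᶠ ε in 𝓝[>] (0 : ℝ), sInf B + ε ∈ B := by
        obtain ⟨b, hbB⟩ := hne
        have hlt : sInf B < b := lt_of_le_of_ne (csInf_le hb hbB) fun h => hinf (h ▸ hbB)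
        have : ∀ᶠ ε in 𝓝 (0 : ℝ), ε < b - sInf B := eventually_lt_nhds (by linarith)
        filter_upwards [this.filter_mono nhdsWithin_le_nhds, self_mem_nhdsWithin] with ε hε hε0
        have : 0 < ε := hε0
        obtain ⟨c, hc, hc'⟩ := exists_lt_of_csInf_lt ⟨b, hbB⟩ (by linarith : sInf B < sInf B + ε)
        exact hconn.out hc hbB ⟨hc'.le, by linarith⟩
      filter_upwards [(h1.and h2).prod_mk (eventually_lt_atBot (sInf B))] with p hp
      rw [hr, ind_of_notMem (x := p.2) fun h => absurd (csInf_le hb h) (not_le.2 hp.2),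
        Finset.sum_eq_single (sInf B)]
      · rw [ind_of_notMem hinf, ind_of_mem hp.1.2]
        simp
      · intro t ht hta
        rw [ind_congr (hp.1.1 t ht hta), sub_self]
      · intro h
        exact absurd (hT (by simp)) h
    · refine ⟨∅, fun T _ => ?_⟩
      have h1 : ∀ᶠ ε in 𝓝[>] (0 : ℝ), ∀ t ∈ T, (t ∈ B ↔ t + ε ∈ B) := by
        rw [eventually_all_finset]
        exact fun t _ => eventually_mem_iff_add_mem hconn ho fun h => absurd h hb
      obtain ⟨b, hbB⟩ := hne
      filter_upwards [h1.prod_mk (eventually_le_atBot b)] with p hp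
      have hM : p.2 ∈ B := by
        rw [not_bddBelow_iff] at hb
        obtain ⟨c, hc, hc'⟩ := hb p.2
        exact hconn.out hc hbB ⟨hc'.le, hp.2⟩
      rw [hr, ind_of_mem hM, Finset.sum_eq_zero]
      · simp
      · intro t ht
        rw [ind_congr (hp.1 t ht), sub_self]

theorem euler_relation_line {ι : Type*} (s : Finset ι) (c : ι → ℤ) (B : ι → Set ℝ)
    (hB : ∀ j ∈ s, RelOpenConvex (B j)) (hne : ∀ j ∈ s, (B j).Nonempty)
    (h : ∀ t, ∑ j ∈ s, c j * ind (B j) t = 0) :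
    ∑ j ∈ s, c j * (-1) ^ Module.finrank ℝ (vectorSpan ℝ (B j)) = 0 := by
  classical
  have hT : ∀ j, ∃ T₀ : Finset ℝ, j ∈ s → ∀ T : Finset ℝ, T₀ ⊆ T →
      ∀ᶠ p in (𝓝[>] (0 : ℝ)) ×ˢ (atBot : Filter ℝ),
      ∑ t ∈ T, (ind (B j) t - ind (B j) (t + p.1)) - ind (B j) p.2 =
        (-1) ^ Module.finrank ℝ (vectorSpan ℝ (B j)) := fun j => by
    by_cases hj : j ∈ s
    · obtain ⟨T, hT⟩ := (hB j hj).exists_jump_sum (hne j hj)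
      exact ⟨T, fun _ => hT⟩
    · exact ⟨∅, fun h => absurd h hj⟩
  choose T₀ hT₀ using hT
  have hev := (eventually_all_finset s).2 fun j hj =>
    hT₀ j hj (s.biUnion T₀) (Finset.subset_biUnion_of_mem T₀ hj)
  obtain ⟨p, hp⟩ := hev.exists
  have hjump : ∀ j ∈ s, c j * (-1) ^ Module.finrank ℝ (vectorSpan ℝ (B j)) =
      ∑ t ∈ s.biUnion T₀, (c j * ind (B j) t - c j * ind (B j) (t + p.1)) -
        c j * ind (B j) p.2 := fun j hj => by
    rw [← hp j hj, mul_sub, Finset.mul_sum]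
    simp_rw [mul_sub]
  rw [Finset.sum_congr rfl hjump, Finset.sum_sub_distrib, Finset.sum_comm]
  simp [h]

/-- The Euler relation: a linear relation among indicators of relatively open convex sets is
inherited by the signs of the dimensions. -/
theorem euler_relation {V ι : Type*} [AddCommGroup V] [Module ℝ V] [FiniteDimensional ℝ V]
    (s : Finset ι) (c : ι → ℤ) (A : ι → Set V)
    (hA : ∀ j ∈ s, RelOpenConvex (A j)) (hne : ∀ j ∈ s, (A j).Nonempty)
    (h : ∀ x, ∑ j ∈ s, c j * ind (A j) x = 0) :
    ∑ j ∈ s, c j * (-1) ^ Module.finrank ℝ (vectorSpan ℝ (A j)) = 0 := by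
  classical
  -- The induction is on the dimension of a direction space `U`, with all sets inside one translate
  -- `p + U`, so that it applies to slices by hyperplanes.
  suffices key : ∀ n : ℕ, ∀ U : Submodule ℝ V, Module.finrank ℝ U = n → ∀ (s : Finset ι)
      (A : ι → Set V) (p : V), (∀ j ∈ s, RelOpenConvex (A j)) → (∀ j ∈ s, (A j).Nonempty) →
      (∀ j ∈ s, ∀ x ∈ A j, x - p ∈ U) → (∀ x, ∑ j ∈ s, c j * ind (A j) x = 0) →
      ∑ j ∈ s, c j * (-1) ^ Module.finrank ℝ (vectorSpan ℝ (A j)) = 0 from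
    key _ ⊤ rfl s A 0 hA hne (by simp) h
  clear h hne hA A s
  intro n
  induction n with
  | zero =>
    intro U hU s A p hA hne hsub h
    have hU' : U = ⊥ := Submodule.finrank_eq_zero.1 hU
    subst hU'
    rw [← h p]
    refine Finset.sum_congr rfl fun j hj => ?_
    have hs : A j = {p} := by
      refine (hne j hj).subset_singleton_iff.1 fun x hx => ?_
      simpa [sub_eq_zero] using hsub j hj x hx
    rw [hs, ind_of_mem (Set.mem_singleton p), vectorSpan_singleton, finrank_bot, pow_zero]
  | succ n ih =>
    intro U hU s A p hA hne hsub h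
    have hU0 : U ≠ ⊥ := by
      rintro rfl
      simp at hU
    obtain ⟨v, hv, hv0⟩ := U.ne_bot_iff.1 hU0
    obtain ⟨f, hf⟩ : ∃ f : V →ₗ[ℝ] ℝ, f v ≠ 0 := by
      by_contra! hcon
      exact hv0 ((Module.forall_dual_apply_eq_zero_iff ℝ v).1 hcon)
    have hker : Module.finrank ℝ ↥(U ⊓ LinearMap.ker f) = n := by
      have h1 := RelOpenConvex.finrank_eq_add U f
      have h2 : U.map f = ⊤ := (eq_bot_or_eq_top _).resolve_left fun hb => hf (by
        have : f v ∈ U.map f := Submodule.mem_map_of_mem hv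
        simpa [hb] using this)
      rw [h2, finrank_top, Module.finrank_self, hU] at h1
      omega
    -- Euler characteristic multiplies over the projection `f`: nonempty fibres of `A j` all have
    -- direction space `vectorSpan ℝ (A j) ⊓ ker f`. The relation required on the line at `t` is the
    -- induction hypothesis for the slices at height `t`.
    have hline := euler_relation_line s
      (fun j => c j * (-1) ^ Module.finrank ℝ ↥(vectorSpan ℝ (A j) ⊓ LinearMap.ker f))
      (fun j => f '' A j) (fun j hj => (hA j hj).image f) (fun j hj => (hne j hj).image f) ?_
    · rw [← hline]
      refine Finset.sum_congr rfl fun j _ => ?_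
      rw [RelOpenConvex.vectorSpan_linear_image, RelOpenConvex.finrank_eq_add _ f, pow_add,
        mul_assoc]
    · intro t
      have hmem : ∀ j, t ∈ f '' A j ↔ (A j ∩ {x | f x = t}).Nonempty := fun j => Iff.rfl
      set s' := s.filter fun j => t ∈ f '' A j with hs'
      have hsum : ∀ g : ι → ℤ, ∑ j ∈ s, g j * ind (f '' A j) t = ∑ j ∈ s', g j := fun g => by
        rw [hs', Finset.sum_filter]
        refine Finset.sum_congr rfl fun j _ => ?_
        by_cases hj : t ∈ f '' A j
        · rw [ind_of_mem hj, if_pos hj, mul_one]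
        · rw [ind_of_notMem hj, if_neg hj, mul_zero]
      rw [hsum]
      rcases s'.eq_empty_or_nonempty with he | ⟨j₀, hj₀⟩
      · rw [he, Finset.sum_empty]
      obtain ⟨q, hq, hqt⟩ := (Finset.mem_filter.1 hj₀).2
      have hj₀s := (Finset.mem_filter.1 hj₀).1
      have := ih (U ⊓ LinearMap.ker f) hker s' (fun j => A j ∩ {x | f x = t}) q
        (fun j hj => (hA j (Finset.mem_filter.1 hj).1).slice f t)
        (fun j hj => (hmem j).1 (Finset.mem_filter.1 hj).2) ?_ ?_
      · rw [← this]
        refine Finset.sum_congr rfl fun j hj => ?_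
        obtain ⟨hj, hjt⟩ := Finset.mem_filter.1 hj
        rw [(hA j hj).vectorSpan_slice f ((hmem j).1 hjt)]
      · rintro j hj x ⟨hx, hxt⟩
        refine ⟨?_, ?_⟩
        · have h1 := U.sub_mem (hsub j (Finset.mem_filter.1 hj).1 x hx) (hsub j₀ hj₀s q hq)
          simpa using h1
        · have hxt : f x = t := hxt
          simp [hxt, hqt]
      · intro x
        by_cases hx : f x = t
        · rw [← h x]
          refine Finset.sum_subset_zero_on_sdiff (Finset.filter_subset _ _) ?_ ?_
          · intro j hj
            rw [Finset.mem_sdiff, Finset.mem_filter, not_and] at hj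
            rw [ind_of_notMem fun hxA => hj.2 hj.1 ⟨x, hxA, hx⟩, mul_zero]
          · intro j _
            rw [ind_congr (show x ∈ A j ∩ {x | f x = t} ↔ x ∈ A j from
              ⟨fun h => h.1, fun h => ⟨h, hx⟩⟩)]
        · refine Finset.sum_eq_zero fun j _ => ?_
          rw [ind_of_notMem fun hxA => hx hxA.2, mul_zero]

end EulerRelation

/-! ### Faces as maximizers and their normal cones -/

section MaxFace

variable {E : Type*} [NormedAddCommGroup E] [NormedSpace ℝ E]

/-- The points of `A` at which the linear functional `u` attains its maximum over `A`. -/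
def maxFace (u : Module.Dual ℝ E) (A : Set E) : Set E :=
  {x ∈ A | ∀ y ∈ A, u y ≤ u x}

theorem maxFace_subset (u : Module.Dual ℝ E) (A : Set E) : maxFace u A ⊆ A := fun _ h => h.1

theorem mem_maxFace_of_le {u : Module.Dual ℝ E} {A : Set E} {x y : E} (hx : x ∈ maxFace u A)
    (hy : y ∈ A) (h : u x ≤ u y) : y ∈ maxFace u A :=
  ⟨hy, fun z hz => (hx.2 z hz).trans h⟩

theorem apply_eq_of_mem_maxFace {u : Module.Dual ℝ E} {A : Set E} {x y : E}
    (hx : x ∈ maxFace u A) (hy : y ∈ maxFace u A) : u x = u y :=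
  le_antisymm (hy.2 x hx.1) (hx.2 y hy.1)

theorem isFace_iff [FiniteDimensional ℝ E] {F P : Set E} :
    IsFace F P ↔ F.Nonempty ∧ ∃ u : Module.Dual ℝ E, F = maxFace u P := by
  refine and_congr_right fun hF => ⟨fun h => ?_, fun ⟨u, hu⟩ _ => ?_⟩
  · obtain ⟨l, hl⟩ := h hF
    exact ⟨l.toLinearMap, hl⟩
  · exact ⟨LinearMap.toContinuousLinearMap u, hu⟩

theorem mem_dualAnnihilator_vectorSpan {F : Set E} {x : E} (hx : x ∈ F)
    (v : Module.Dual ℝ E) :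
    v ∈ (vectorSpan ℝ F).dualAnnihilator ↔ ∀ y ∈ F, v y = v x := by
  rw [vectorSpan_eq_span_vsub_set_right ℝ hx, ← SetLike.mem_coe,
    Submodule.coe_dualAnnihilator_span]
  simp only [Set.mem_ofPred_eq, Set.subset_def, Set.mem_image, SetLike.mem_coe,
    LinearMap.mem_ker, vsub_eq_sub, forall_exists_index, and_imp, forall_apply_eq_imp_iff₂,
    map_sub, sub_eq_zero]

theorem apply_le_of_mem_convexHull (u : Module.Dual ℝ E) {s : Set E} {a : ℝ}
    (h : ∀ x ∈ s, u x ≤ a) {x : E} (hx : x ∈ convexHull ℝ s) : u x ≤ a :=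
  convexHull_min (t := {x | u x ≤ a}) h (convex_halfSpace_le u.isLinear a) hx

/-- Slack in finitely many inequalities allows for a small perturbation. -/
theorem exists_pos_mul_le {α : Type*} (s : Finset α) (a b : α → ℝ) (ha : ∀ x ∈ s, 0 ≤ a x)
    (hab : ∀ x ∈ s, a x = 0 → b x ≤ 0) : ∃ ε : ℝ, 0 < ε ∧ ∀ x ∈ s, ε * b x ≤ a x := by
  have h : ∀ᶠ ε in nhdsWithin (0 : ℝ) (Set.Ioi 0), ∀ x ∈ s, ε * b x ≤ a x := by
    rw [Filter.eventually_all_finset]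
    intro x hx
    rcases (ha x hx).eq_or_lt with h0 | h0
    · filter_upwards [self_mem_nhdsWithin] with ε hε
      rw [← h0]
      exact mul_nonpos_of_nonneg_of_nonpos (le_of_lt hε) (hab x hx h0.symm)
    · have hlim : Filter.Tendsto (fun ε : ℝ => ε * b x) (nhds 0) (nhds (0 * b x)) :=
        (continuous_id.mul continuous_const).tendsto 0
      rw [zero_mul] at hlim
      exact ((hlim.eventually (eventually_lt_nhds h0)).filter_mono nhdsWithin_le_nhds).mono
        fun _ h => h.le
  obtain ⟨ε, h1, h2⟩ := (h.and self_mem_nhdsWithin).exists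
  exact ⟨ε, h2, h1⟩

theorem exists_mem_maxFace_convexHull {s : Finset E} (hs : s.Nonempty) (u : Module.Dual ℝ E) :
    ∃ x ∈ s, x ∈ maxFace u (convexHull ℝ (s : Set E)) := by
  obtain ⟨x, hx, h⟩ := s.exists_max_image u hs
  exact ⟨x, hx, subset_convexHull ℝ _ hx, fun y hy => apply_le_of_mem_convexHull u h hy⟩

theorem IsPolytope.maxFace_nonempty {P : Set E} (hP : IsPolytope P) (u : Module.Dual ℝ E) :
    (maxFace u P).Nonempty := by
  obtain ⟨s, hs, rfl⟩ := hP
  obtain ⟨x, -, hx⟩ := exists_mem_maxFace_convexHull hs u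
  exact ⟨x, hx⟩

theorem IsPolytope.nonempty {P : Set E} (hP : IsPolytope P) : P.Nonempty :=
  (hP.maxFace_nonempty 0).mono (maxFace_subset _ _)

theorem IsPolytope.isCompact {P : Set E} (hP : IsPolytope P) : IsCompact P := by
  obtain ⟨s, -, rfl⟩ := hP
  exact s.finite_toSet.isCompact_convexHull (𝕜 := ℝ)

theorem maxFace_zero (A : Set E) : maxFace 0 A = A :=
  Set.Subset.antisymm (maxFace_subset _ _) fun _ hx => ⟨hx, fun _ _ => le_rfl⟩

/-- A face is determined by the generators it contains: for small `ε > 0` the functional `u - ε • v`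
is still maximal at `x₀`, which bounds `v` from below on the face of `u`. -/
theorem maxFace_convexHull_subset {s : Finset E} (hs : s.Nonempty) {u v : Module.Dual ℝ E}
    (h : ∀ x ∈ s, x ∈ maxFace u (convexHull ℝ (s : Set E)) ↔
      x ∈ maxFace v (convexHull ℝ (s : Set E))) :
    maxFace u (convexHull ℝ (s : Set E)) ⊆ maxFace v (convexHull ℝ (s : Set E)) := by
  obtain ⟨x₀, hx₀, hmax⟩ := exists_mem_maxFace_convexHull hs u
  have hmaxv := (h x₀ hx₀).1 hmax
  obtain ⟨ε, hε, hle⟩ := exists_pos_mul_le s (fun x => u x₀ - u x) (fun x => v x₀ - v x)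
    (fun x hx => sub_nonneg.2 (hmax.2 x (subset_convexHull ℝ _ hx))) fun x hx hx0 => by
      have hxu := mem_maxFace_of_le hmax (subset_convexHull ℝ _ hx) (sub_eq_zero.1 hx0).le
      rw [apply_eq_of_mem_maxFace hmaxv ((h x hx).1 hxu), sub_self]
  intro x hx
  have hlin := apply_le_of_mem_convexHull (u - ε • v) (a := u x₀ - ε * v x₀) (s := (s : Set E))
    (fun y hy => by
      have := hle y hy
      simp only [LinearMap.sub_apply, LinearMap.smul_apply, smul_eq_mul]
      linarith) hx.1
  simp only [LinearMap.sub_apply, LinearMap.smul_apply, smul_eq_mul] at hlin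
  have hux := apply_eq_of_mem_maxFace hx hmax
  refine mem_maxFace_of_le hmaxv hx.1 (le_of_mul_le_mul_left (?_ : ε * _ ≤ ε * _) hε)
  linarith

theorem IsPolytope.finite_faces [FiniteDimensional ℝ E] {P : Set E} (hP : IsPolytope P) :
    {F : Set E | IsFace F P}.Finite := by
  obtain ⟨s, hs, rfl⟩ := hP
  refine Set.Finite.of_finite_image (f := fun F => F ∩ (s : Set E))
    (s.finite_toSet.finite_subsets.subset ?_) ?_
  · rintro _ ⟨F, -, rfl⟩
    exact Set.inter_subset_right
  · intro F hF F' hF' heq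
    obtain ⟨-, u, rfl⟩ := isFace_iff.1 hF
    obtain ⟨-, v, rfl⟩ := isFace_iff.1 hF'
    have h : ∀ x ∈ s, x ∈ maxFace u (convexHull ℝ (s : Set E)) ↔
        x ∈ maxFace v (convexHull ℝ (s : Set E)) := fun x hx => by
      have := Set.ext_iff.1 heq x
      simpa [hx] using this
    exact (maxFace_convexHull_subset hs h).antisymm
      (maxFace_convexHull_subset hs fun x hx => (h x hx).symm)

/-- Generators off the face have positive slack. Spending at most half of it on the perturbation
keeps them strictly below the maximum. -/
theorem IsPolytope.exists_maxFace_add_smul {P : Set E} (hP : IsPolytope P)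
    {u v : Module.Dual ℝ E} {x₀ : E} (hx₀ : x₀ ∈ maxFace u P)
    (hv : ∀ x ∈ maxFace u P, v x = v x₀) :
    ∃ ε : ℝ, 0 < ε ∧ maxFace (u + ε • v) P = maxFace u P := by
  obtain ⟨s, hs, rfl⟩ := hP
  obtain ⟨ε, hε, hle⟩ := exists_pos_mul_le s (fun x => (u x₀ - u x) / 2) (fun x => v x - v x₀)
    (fun x hx => by linarith [hx₀.2 x (subset_convexHull ℝ _ hx)]) fun x hx h0 => by
      have : u x₀ ≤ u x := by linarith
      rw [hv x (mem_maxFace_of_le hx₀ (subset_convexHull ℝ _ hx) this), sub_self]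
  have hlin : ∀ x ∈ convexHull ℝ (s : Set E),
      u x + ε * v x - (u x₀ + ε * v x₀) ≤ (u x - u x₀) / 2 := fun x hx => by
    have := apply_le_of_mem_convexHull ((1 / 2 : ℝ) • u + ε • v) (a := u x₀ / 2 + ε * v x₀)
      (s := (s : Set E)) (fun y hy => by
        have := hle y hy
        simp only [LinearMap.add_apply, LinearMap.smul_apply, smul_eq_mul]
        linarith) hx
    simp only [LinearMap.add_apply, LinearMap.smul_apply, smul_eq_mul] at this
    linarith
  refine ⟨ε, hε, Set.Subset.antisymm (fun x hx => ?_) fun x hx => ⟨hx.1, fun y hy => ?_⟩⟩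
  · refine mem_maxFace_of_le hx₀ hx.1 ?_
    have h1 := hx.2 x₀ hx₀.1
    simp only [LinearMap.add_apply, LinearMap.smul_apply, smul_eq_mul] at h1
    linarith [hlin x hx.1]
  · simp only [LinearMap.add_apply, LinearMap.smul_apply, smul_eq_mul]
    rw [hv x hx, apply_eq_of_mem_maxFace hx hx₀]
    linarith [hlin y hy, hx₀.2 y hy]

/-- The relatively open normal cone of a face `F` of `P`. -/
def normalCell (P F : Set E) : Set (Module.Dual ℝ E) := {u | maxFace u P = F}

theorem IsPolytope.relOpenConvex_normalCell {P F : Set E} (hP : IsPolytope P) :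
    RelOpenConvex (normalCell P F) := by
  constructor
  · intro u hu v hv a b ha hb hab
    have hu : maxFace u P = F := hu
    have hv : maxFace v P = F := hv
    obtain ⟨x₀, hx₀⟩ := hP.maxFace_nonempty u
    have hx₀v : x₀ ∈ maxFace v P := by rwa [hv, ← hu]
    refine Set.Subset.antisymm (fun x hx => ?_) fun x hx => ?_
    · have h1 := hx.2 x₀ hx₀.1
      simp only [LinearMap.add_apply, LinearMap.smul_apply, smul_eq_mul] at h1
      have h2 := hx₀.2 x hx.1
      have h3 := hx₀v.2 x hx.1
      rcases ha.eq_or_lt with rfl | ha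
      · rw [← hv]
        refine mem_maxFace_of_le hx₀v hx.1 ?_
        have : b = 1 := by linarith
        subst this
        linarith
      · rw [← hu]
        refine mem_maxFace_of_le hx₀ hx.1 (le_of_mul_le_mul_left (?_ : a * _ ≤ a * _) ha)
        linarith [mul_le_mul_of_nonneg_left h3 hb]
    · have hxu : x ∈ maxFace u P := by rwa [hu]
      have hxv : x ∈ maxFace v P := by rwa [hv]
      refine ⟨hxu.1, fun y hy => ?_⟩
      simp only [LinearMap.add_apply, LinearMap.smul_apply, smul_eq_mul]
      exact add_le_add (mul_le_mul_of_nonneg_left (hxu.2 y hy) ha)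
        (mul_le_mul_of_nonneg_left (hxv.2 y hy) hb)
  · intro u hu v hv
    have hu : maxFace u P = F := hu
    have hv : maxFace v P = F := hv
    obtain ⟨x₀, hx₀⟩ := hP.maxFace_nonempty u
    -- Both `u` and `v` are constant on `F`, hence so is `u - v`, and a small step in that direction
    -- keeps the face.
    obtain ⟨ε, hε, h⟩ := hP.exists_maxFace_add_smul (v := u - v) hx₀ fun x hx => by
      rw [LinearMap.sub_apply, LinearMap.sub_apply, apply_eq_of_mem_maxFace hx hx₀]
      rw [hu, ← hv] at hx hx₀
      rw [apply_eq_of_mem_maxFace hx hx₀]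
    exact ⟨ε, hε, h.trans hu⟩

theorem IsPolytope.vectorSpan_normalCell {P F : Set E} (hP : IsPolytope P)
    (hne : (normalCell P F).Nonempty) :
    vectorSpan ℝ (normalCell P F) = (vectorSpan ℝ F).dualAnnihilator := by
  obtain ⟨u, hu⟩ := hne
  have hu' : maxFace u P = F := hu
  obtain ⟨x₀, hx₀⟩ := hP.maxFace_nonempty u
  ext v
  rw [hP.relOpenConvex_normalCell.mem_vectorSpan_iff hu,
    mem_dualAnnihilator_vectorSpan (by rwa [← hu'] : x₀ ∈ F)]
  constructor
  · rintro ⟨ε, hε, h⟩ x hx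
    have h : maxFace (u + ε • v) P = F := h
    have h1 := apply_eq_of_mem_maxFace (by rwa [hu'] : x ∈ maxFace u P) hx₀
    have h2 := apply_eq_of_mem_maxFace (by rwa [h] : x ∈ maxFace (u + ε • v) P)
      (by rwa [h, ← hu'] : x₀ ∈ maxFace (u + ε • v) P)
    simp only [LinearMap.add_apply, LinearMap.smul_apply, smul_eq_mul] at h2
    exact mul_left_cancel₀ hε.ne' (by linarith)
  · intro hv
    obtain ⟨ε, hε, h⟩ := hP.exists_maxFace_add_smul hx₀ fun x hx => hv x (by rwa [← hu'])
    exact ⟨ε, hε, h.trans hu'⟩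

theorem IsPolytope.dim_add_finrank_normalCell [FiniteDimensional ℝ E] {P F : Set E}
    (hP : IsPolytope P) (hne : (normalCell P F).Nonempty) :
    dim F + Module.finrank ℝ (vectorSpan ℝ (normalCell P F)) = Module.finrank ℝ E := by
  rw [hP.vectorSpan_normalCell hne, dim, Subspace.finrank_add_finrank_dualAnnihilator_eq]

end MaxFace

theorem update_mem {E ι : Type*} [DecidableEq ι] {P : ι → Set E} {g : ι → E}
    (hg : ∀ i, g i ∈ P i) {i : ι} {y : E} (hy : y ∈ P i) (j : ι) :
    Function.update g i y j ∈ P j := by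
  by_cases hj : j = i
  · subst hj
    simpa using hy
  · simpa [hj] using hg j

/-! ### Faces of Minkowski sums -/

section Sums

variable {E ι : Type*} [NormedAddCommGroup E] [NormedSpace ℝ E] [Fintype ι]

theorem sum_mem_maxFace_sum_iff {P : ι → Set E} (u : Module.Dual ℝ E) {g : ι → E}
    (hg : ∀ i, g i ∈ P i) :
    ∑ i, g i ∈ maxFace u (∑ i, P i) ↔ ∀ i, g i ∈ maxFace u (P i) := by
  classical
  constructor
  · refine fun h i => ⟨hg i, fun y hy => ?_⟩
    have := h.2 _ ((Set.mem_fintype_sum _ _).2 ⟨_, fun j => update_mem hg hy j, rfl⟩)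
    rw [Finset.sum_update_of_mem (Finset.mem_univ i),
      ← Finset.add_sum_erase _ g (Finset.mem_univ i), Finset.sdiff_singleton_eq_erase] at this
    simp only [map_add] at this
    linarith
  · refine fun h => ⟨(Set.mem_fintype_sum _ _).2 ⟨g, fun j => hg j, rfl⟩, fun y hy => ?_⟩
    obtain ⟨g', hg', rfl⟩ := (Set.mem_fintype_sum _ _).1 hy
    rw [map_sum, map_sum]
    exact Finset.sum_le_sum fun i _ => (h i).2 _ (hg' i)

theorem maxFace_sum (P : ι → Set E) (u : Module.Dual ℝ E) :
    maxFace u (∑ i, P i) = ∑ i, maxFace u (P i) := by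
  ext x
  constructor
  · intro hx
    obtain ⟨g, hg, rfl⟩ := (Set.mem_fintype_sum _ _).1 hx.1
    have := (sum_mem_maxFace_sum_iff u hg).1 hx
    exact (Set.mem_fintype_sum _ _).2 ⟨g, fun i => this i, rfl⟩
  · intro hx
    obtain ⟨g, hg, rfl⟩ := (Set.mem_fintype_sum _ _).1 hx
    exact (sum_mem_maxFace_sum_iff u fun i => maxFace_subset _ _ (hg i)).2 hg

/-- Makes the passage from a face of the sum to its summands well defined and monotone,
independently of the functional chosen. -/
theorem maxFace_subset_of_sum_subset {P : ι → Set E} (hP : ∀ i, IsPolytope (P i))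
    {u v : Module.Dual ℝ E} (h : maxFace u (∑ i, P i) ⊆ maxFace v (∑ i, P i)) (i : ι) :
    maxFace u (P i) ⊆ maxFace v (P i) := by
  classical
  intro x hx
  choose g hg using fun j => (hP j).maxFace_nonempty u
  have hg' := update_mem hg hx
  have := (sum_mem_maxFace_sum_iff v fun j => (hg' j).1).1
    (h ((sum_mem_maxFace_sum_iff u fun j => (hg' j).1).2 hg')) i
  simpa using this

theorem isPolytope_sum {P : ι → Set E} (hP : ∀ i, IsPolytope (P i)) :
    IsPolytope (∑ i, P i) := by
  classical
  choose s hs hsP using hP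
  refine ⟨∑ i, s i, ?_, ?_⟩
  · choose g hg using hs
    rw [← Finset.coe_nonempty, Finset.coe_sum]
    exact ⟨∑ i, g i, (Set.mem_fintype_sum _ _).2 ⟨g, fun i => hg i, rfl⟩⟩
  · rw [Finset.coe_sum, convexHull_sum]
    exact Finset.sum_congr rfl fun i _ => hsP i

theorem vectorSpan_sum {P : ι → Set E} (hP : ∀ i, (P i).Nonempty) :
    vectorSpan ℝ (∑ i, P i) = ⨆ i, vectorSpan ℝ (P i) := by
  classical
  apply le_antisymm
  · rw [vectorSpan_def, Submodule.span_le]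
    rintro _ ⟨x, hx, y, hy, rfl⟩
    obtain ⟨g, hg, rfl⟩ := (Set.mem_fintype_sum _ _).1 hx
    obtain ⟨g', hg', rfl⟩ := (Set.mem_fintype_sum _ _).1 hy
    simp only [vsub_eq_sub, ← Finset.sum_sub_distrib]
    exact Submodule.sum_mem _ fun i _ =>
      Submodule.mem_iSup_of_mem i (vsub_mem_vectorSpan ℝ (hg i) (hg' i))
  · refine iSup_le fun i => ?_
    rw [vectorSpan_def, Submodule.span_le]
    rintro _ ⟨x, hx, y, hy, rfl⟩
    choose g hg using hP
    have hmem : ∀ z ∈ P i, z + ∑ j ∈ Finset.univ \ {i}, g j ∈ ∑ j, P j := fun z hz => by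
      rw [← Finset.sum_update_of_mem (Finset.mem_univ i)]
      exact (Set.mem_fintype_sum _ _).2 ⟨_, fun j => update_mem hg hz j, rfl⟩
    have := vsub_mem_vectorSpan ℝ (hmem x hx) (hmem y hy)
    simpa using this

theorem sum_faces_lying_over [FiniteDimensional ℝ E] {P : ι → Set E}
    (hP : ∀ i, IsPolytope (P i)) (i : ι) (φ : Set E → Set E)
    (hφ : ∀ u, φ (maxFace u (∑ i, P i)) = maxFace u (P i)) {G : Set E} (hG : IsFace G (P i))
    (S : Finset (Set E)) (hS : ∀ F, F ∈ S ↔ IsFace F (∑ i, P i) ∧ φ F = G) :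
    ∑ F ∈ S, (-1 : ℤ) ^ dim F = (-1) ^ dim G := by
  classical
  have hsum := isPolytope_sum hP
  have hmemS : ∀ u, maxFace u (∑ i, P i) ∈ S ↔ maxFace u (P i) = G := fun u => by
    rw [hS, isFace_iff, hφ]
    exact and_iff_right ⟨hsum.maxFace_nonempty u, u, rfl⟩
  have hneG : (normalCell (P i) G).Nonempty := by
    obtain ⟨-, u, rfl⟩ := isFace_iff.1 hG
    exact ⟨u, rfl⟩
  have hne : ∀ F ∈ S, (normalCell (∑ i, P i) F).Nonempty := fun F hF => by
    obtain ⟨-, u, rfl⟩ := isFace_iff.1 ((hS F).1 hF).1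
    exact ⟨u, rfl⟩
  -- The index `none` carries the cone of `G` with coefficient 1, and the cones of the faces over
  -- `G` have coefficient -1. The indicators cancel because each functional selects exactly one face
  -- of the sum.
  have key := euler_relation (Finset.insertNone S)
    (fun o => o.elim (1 : ℤ) fun _ => -1)
    (fun o => o.elim (normalCell (P i) G) fun F => normalCell (∑ i, P i) F) ?_ ?_ ?_
  · rw [Finset.sum_insertNone] at key
    simp only [Option.elim_none, Option.elim_some, one_mul, neg_one_mul,
      Finset.sum_neg_distrib] at key
    have hsign : ∀ a b n : ℕ, a + b = n → (-1 : ℤ) ^ a = (-1) ^ n * (-1) ^ b := by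
      rintro a b _ rfl
      rw [pow_add, mul_assoc, ← mul_pow]
      simp
    rw [hsign _ _ _ ((hP i).dim_add_finrank_normalCell hneG),
      Finset.sum_congr rfl fun F hF =>
        hsign _ _ _ (hsum.dim_add_finrank_normalCell (hne F hF)),
      ← Finset.mul_sum]
    rw [← sub_eq_add_neg, sub_eq_zero] at key
    exact congrArg _ key.symm
  · rintro (_ | F) _
    · exact (hP i).relOpenConvex_normalCell
    · exact hsum.relOpenConvex_normalCell
  · rintro (_ | F) hF
    · exact hneG
    · exact hne F (by simpa using hF)
  · intro u
    rw [Finset.sum_insertNone]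
    simp only [Option.elim_none, Option.elim_some, one_mul, neg_one_mul, Finset.sum_neg_distrib]
    have h1 : ∑ F ∈ S, ind (normalCell (∑ i, P i) F) u =
        if maxFace u (∑ i, P i) ∈ S then 1 else 0 := by
      rw [← Finset.sum_ite_eq S (maxFace u (∑ i, P i)) fun _ => (1 : ℤ)]
      refine Finset.sum_congr rfl fun F _ => ?_
      split_ifs with h
      · exact ind_of_mem h
      · exact ind_of_notMem h
    rw [h1]
    split_ifs with h
    · rw [ind_of_mem (show u ∈ normalCell (P i) G from (hmemS u).1 h)]
      norm_num
    · rw [ind_of_notMem (fun h' => h ((hmemS u).2 h') : u ∉ normalCell (P i) G)]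
      norm_num

end Sums

/-! ### Independent directions and facets -/

section Dimension

/-- The dimension of a sum of subspaces is the sum of the dimensions if and only if the subspaces
are independent. -/
theorem finrank_iSup_eq_sum_iff {E ι : Type*} [AddCommGroup E] [Module ℝ E]
    [FiniteDimensional ℝ E] [Fintype ι] (V : ι → Submodule ℝ E) :
    Module.finrank ℝ ↥(⨆ i, V i) = ∑ i, Module.finrank ℝ (V i) ↔
      ∀ x : ι → E, (∀ i, x i ∈ V i) → ∑ i, x i = 0 → ∀ i, x i = 0 := by
  classical
  -- Rank-nullity for the summation map: the dimensions add up exactly when its kernel vanishes.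
  let Φ : (∀ i, V i) →ₗ[ℝ] E := LinearMap.lsum ℝ (fun i => V i) ℝ fun i => (V i).subtype
  have hΦ : ∀ x, Φ x = ∑ i, (x i : E) := fun x => by simp [Φ, LinearMap.lsum_apply]
  have hrange : LinearMap.range Φ = ⨆ i, V i := by
    apply le_antisymm
    · rintro _ ⟨x, rfl⟩
      rw [hΦ]
      exact Submodule.sum_mem _ fun i _ => Submodule.mem_iSup_of_mem i (x i).2
    · refine iSup_le fun i y hy => ⟨Pi.single i ⟨y, hy⟩, ?_⟩
      rw [hΦ, Finset.sum_eq_single i]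
      · simp
      · intro j _ hj
        simp [Pi.single_eq_of_ne hj]
      · simp
  have hrn := Φ.finrank_range_add_finrank_ker
  rw [hrange, Module.finrank_pi_fintype] at hrn
  have h1 : Module.finrank ℝ ↥(⨆ i, V i) = ∑ i, Module.finrank ℝ (V i) ↔
      LinearMap.ker Φ = ⊥ := by
    rw [← Submodule.finrank_eq_zero (R := ℝ)]
    omega
  rw [h1, LinearMap.ker_eq_bot']
  constructor
  · intro h x hx h0 i
    have := congrFun (h (fun i => ⟨x i, hx i⟩) (by rw [hΦ]; exact h0)) i
    exact congrArg Subtype.val this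
  · intro h x hx
    rw [hΦ] at hx
    ext i
    exact h (fun i => x i) (fun i => (x i).2) hx i

variable {E : Type*} [NormedAddCommGroup E] [NormedSpace ℝ E] [FiniteDimensional ℝ E]

theorem dim_mono {A B : Set E} (h : A ⊆ B) : dim A ≤ dim B :=
  Submodule.finrank_mono (vectorSpan_mono ℝ h)

/-- Equal dimension forces equal direction spaces, so `u` is constant on `B`. -/
theorem subset_maxFace_of_dim_le {P B : Set E} {u : Module.Dual ℝ E}
    (hne : (maxFace u P).Nonempty) (hsub : maxFace u P ⊆ B) (hB : B ⊆ P)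
    (hdim : dim B ≤ dim (maxFace u P)) : B ⊆ maxFace u P := by
  obtain ⟨x₀, hx₀⟩ := hne
  have hspan : vectorSpan ℝ (maxFace u P) = vectorSpan ℝ B :=
    Submodule.eq_of_le_of_finrank_le (vectorSpan_mono ℝ hsub) hdim
  have hu := (mem_dualAnnihilator_vectorSpan hx₀ u).2 fun y hy => apply_eq_of_mem_maxFace hy hx₀
  rw [hspan, mem_dualAnnihilator_vectorSpan (hsub hx₀)] at hu
  exact fun x hx => mem_maxFace_of_le hx₀ (hB hx) (hu x hx).ge

theorem IsPolytope.dim_maxFace_lt {P : Set E} (hP : IsPolytope P) {u : Module.Dual ℝ E}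
    (hne : maxFace u P ≠ P) : dim (maxFace u P) < dim P := by
  by_contra! h
  exact hne ((maxFace_subset u P).antisymm (subset_maxFace_of_dim_le (hP.maxFace_nonempty u)
    (maxFace_subset u P) subset_rfl h))

/-- A proper face of codimension at least two is properly contained in another proper face. -/
theorem IsPolytope.exists_larger_maxFace {P : Set E} (hP : IsPolytope P) {w : Module.Dual ℝ E}
    (hne : maxFace w P ≠ P) (hdim : dim (maxFace w P) + 1 ≠ dim P) :
    ∃ w', maxFace w' P ≠ P ∧ maxFace w P ⊆ maxFace w' P ∧
      dim (maxFace w P) < dim (maxFace w' P) := by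
  have hlt := hP.dim_maxFace_lt hne
  obtain ⟨x₀, hx₀⟩ := hP.maxFace_nonempty w
  have hwL : w ∉ (vectorSpan ℝ P).dualAnnihilator := fun h => hne <| by
    rw [mem_dualAnnihilator_vectorSpan hx₀.1] at h
    exact (maxFace_subset w P).antisymm fun y hy => mem_maxFace_of_le hx₀ hy (h y hy).ge
  have hrL := Subspace.finrank_add_finrank_dualAnnihilator_eq (vectorSpan ℝ P)
  have hrN := Subspace.finrank_add_finrank_dualAnnihilator_eq (vectorSpan ℝ (maxFace w P))
  -- Codimension at least two leaves room for a `v` constant on the face but independent of `w`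
  -- modulo functionals constant on `P`.
  obtain ⟨v, hvN, hvL⟩ : ∃ v ∈ (vectorSpan ℝ (maxFace w P)).dualAnnihilator,
      v ∉ (vectorSpan ℝ P).dualAnnihilator ⊔ Submodule.span ℝ {w} := by
    by_contra! hcon
    have h1 := Submodule.finrank_mono (R := ℝ) hcon
    have h2 := Submodule.finrank_add_le_finrank_add_finrank (vectorSpan ℝ P).dualAnnihilator
      (Submodule.span ℝ {w})
    have h3 := finrank_span_le_card (R := ℝ) ({w} : Set (Module.Dual ℝ E))
    simp only [Set.toFinset_singleton, Finset.card_singleton] at h3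
    unfold dim at hlt hdim
    omega
  obtain ⟨s, hs, rfl⟩ := hP
  -- Up to sign, `v` exceeds its value on the face at some generator; otherwise it would be constant
  -- on `P`.
  obtain ⟨v, hvN, hvL, x₁, hx₁, hv₁⟩ : ∃ v ∈ (vectorSpan ℝ
      (maxFace w (convexHull ℝ (s : Set E)))).dualAnnihilator,
      v ∉ (vectorSpan ℝ (convexHull ℝ (s : Set E))).dualAnnihilator ⊔ Submodule.span ℝ {w} ∧
      ∃ x ∈ s, v x₀ < v x := by
    by_cases h1 : ∃ x ∈ s, v x₀ < v x
    · exact ⟨v, hvN, hvL, h1⟩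
    by_cases h2 : ∃ x ∈ s, (-v) x₀ < (-v) x
    · exact ⟨-v, Submodule.neg_mem _ hvN, fun h => hvL (neg_neg v ▸ Submodule.neg_mem _ h), h2⟩
    push Not at h1 h2
    refine absurd (Submodule.mem_sup_left ?_) hvL
    rw [mem_dualAnnihilator_vectorSpan hx₀.1]
    intro y hy
    have h1' := apply_le_of_mem_convexHull v h1 hy
    have h2' := apply_le_of_mem_convexHull (-v) h2 hy
    simp only [LinearMap.neg_apply] at h2'
    linarith
  rw [mem_dualAnnihilator_vectorSpan hx₀] at hvN
  -- Ratio test: tilt `w` towards `v` until the first generator `z` with `v x₀ < v z` joins the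
  -- face.
  obtain ⟨z, hz, hmin⟩ := (s.filter fun x => v x₀ < v x).exists_min_image
    (fun x => (w x₀ - w x) / (v x - v x₀)) ⟨x₁, Finset.mem_filter.2 ⟨hx₁, hv₁⟩⟩
  obtain ⟨hzs, hvz⟩ := Finset.mem_filter.1 hz
  set t := (w x₀ - w z) / (v z - v x₀) with ht
  have hz' := subset_convexHull ℝ (s : Set E) hzs
  have ht0 : 0 ≤ t := div_nonneg (sub_nonneg.2 (hx₀.2 z hz')) (by linarith)
  have htz : t * (v z - v x₀) = w x₀ - w z := div_mul_cancel₀ _ (by linarith)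
  have happ : ∀ x, (w + t • v) x = w x + t * v x := fun x => by simp
  have hx₀' : x₀ ∈ maxFace (w + t • v) (convexHull ℝ (s : Set E)) := by
    refine ⟨hx₀.1, fun y hy => apply_le_of_mem_convexHull _ (fun x hx => ?_) hy⟩
    rw [happ, happ]
    have hwx := hx₀.2 x (subset_convexHull ℝ _ hx)
    rcases le_or_gt (v x) (v x₀) with h | h
    · linarith [mul_le_mul_of_nonneg_left h ht0]
    · have := hmin x (Finset.mem_filter.2 ⟨hx, h⟩)
      rw [le_div_iff₀ (by linarith)] at this
      linarith
  have hsub : maxFace w (convexHull ℝ (s : Set E)) ⊆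
      maxFace (w + t • v) (convexHull ℝ (s : Set E)) := fun x hx => by
    refine mem_maxFace_of_le hx₀' hx.1 ?_
    rw [happ, happ, hvN x hx, apply_eq_of_mem_maxFace hx hx₀]
  refine ⟨w + t • v, fun heq => ?_, hsub, ?_⟩
  · have hL : w + t • v ∈ (vectorSpan ℝ (convexHull ℝ (s : Set E))).dualAnnihilator := by
      rw [mem_dualAnnihilator_vectorSpan hx₀.1]
      exact fun y hy => apply_eq_of_mem_maxFace (by rwa [heq]) hx₀'
    rcases ht0.eq_or_lt with h0 | h0
    · rw [← h0, zero_smul, add_zero] at hL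
      exact hwL hL
    · refine hvL ((Submodule.smul_mem_iff _ h0.ne').1 ?_)
      have := Submodule.sub_mem _ (Submodule.mem_sup_left (T := Submodule.span ℝ {w}) hL)
        (Submodule.mem_sup_right (Submodule.mem_span_singleton_self w))
      rwa [add_sub_cancel_left] at this
  · by_contra! hle
    have hzmem : z ∈ maxFace (w + t • v) (convexHull ℝ (s : Set E)) := by
      refine mem_maxFace_of_le hx₀' hz' ?_
      rw [happ, happ]
      linarith
    have := hvN z (subset_maxFace_of_dim_le ⟨x₀, hx₀⟩ hsub (maxFace_subset _ _) hle hzmem)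
    linarith

theorem IsPolytope.exists_facet {P : Set E} (hP : IsPolytope P) {u : Module.Dual ℝ E}
    (hne : maxFace u P ≠ P) :
    ∃ w, IsFacet (maxFace w P) P ∧ maxFace u P ⊆ maxFace w P := by
  induction hk : dim P - dim (maxFace u P) using Nat.strong_induction_on generalizing u with
  | _ k ih =>
    by_cases hdim : dim (maxFace u P) + 1 = dim P
    · exact ⟨u, ⟨isFace_iff.2 ⟨hP.maxFace_nonempty u, u, rfl⟩, hdim⟩, subset_rfl⟩
    · obtain ⟨w', hw', hsub, hlt⟩ := hP.exists_larger_maxFace hne hdim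
      have := hP.dim_maxFace_lt hw'
      obtain ⟨w, hw, hsub'⟩ := ih _ (by omega) hw' rfl
      exact ⟨w, hw, hsub.trans hsub'⟩

end Dimension

/-! ### Uniqueness and exactness of decompositions -/

section Decomposition

variable {E : Type*} [NormedAddCommGroup E] [NormedSpace ℝ E] [FiniteDimensional ℝ E] {r : ℕ}
  {P : Fin r → Set E}

/-- The decomposition of a face of a Minkowski sum is unique. -/
theorem IsDecomposition.eq_maxFace (hP : ∀ i, IsPolytope (P i)) {w : Module.Dual ℝ E}
    {G : Fin r → Set E} (hG : IsDecomposition P (maxFace w (∑ i, P i)) G) (i : Fin r) :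
    G i = maxFace w (P i) := by
  classical
  obtain ⟨hface, hsum⟩ := hG
  have hGP : ∀ j, G j ⊆ P j := fun j => by
    obtain ⟨-, v, hv⟩ := isFace_iff.1 (hface j)
    rw [hv]
    exact maxFace_subset _ _
  have hsub : ∀ g : Fin r → E, (∀ j, g j ∈ G j) → ∀ j, g j ∈ maxFace w (P j) := fun g hg => by
    refine (sum_mem_maxFace_sum_iff w fun j => hGP j (hg j)).1 ?_
    rw [hsum]
    exact (Set.mem_fintype_sum _ _).2 ⟨g, fun j => hg j, rfl⟩
  choose g₀ hg₀ using fun j => (hface j).1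
  obtain ⟨-, v, hv⟩ := isFace_iff.1 (hface i)
  refine Set.Subset.antisymm (fun x hx => ?_) fun x hx => ?_
  · simpa using hsub _ (update_mem hg₀ hx) i
  -- Put `x` in place `i` and `v`-minimizers of the maximal faces elsewhere. Rewriting this sum with
  -- points of the `G j` cannot lower `v` in the other places, so `v x` is at least the maximum of
  -- `v` on `P i`.
  · have hmin : ∀ j, ∃ y ∈ maxFace w (P j), ∀ z ∈ maxFace w (P j), v y ≤ v z := fun j => by
      have hexp : IsExposed ℝ (P j) (maxFace w (P j)) :=
        (isFace_iff.2 ⟨(hP j).maxFace_nonempty w, w, rfl⟩).2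
      exact (hexp.isCompact (hP j).isCompact).exists_isMinOn ((hP j).maxFace_nonempty w)
        v.continuous_of_finiteDimensional.continuousOn
    choose y hy hymin using hmin
    have hxy := update_mem hy hx
    have hmem : ∑ j, Function.update y i x j ∈ ∑ j, G j := by
      rw [← hsum]
      exact (sum_mem_maxFace_sum_iff w fun j => (hxy j).1).2 hxy
    obtain ⟨g, hg, hgsum⟩ := (Set.mem_fintype_sum _ _).1 hmem
    have hgmax := hsub g fun j => hg j
    have heq := congrArg v hgsum
    rw [map_sum, Finset.sum_update_of_mem (Finset.mem_univ i), map_add, map_sum,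
      ← Finset.add_sum_erase _ _ (Finset.mem_univ i), Finset.sdiff_singleton_eq_erase] at heq
    have hle : ∑ j ∈ Finset.univ.erase i, v (y j) ≤ ∑ j ∈ Finset.univ.erase i, v (g j) :=
      Finset.sum_le_sum fun j _ => hymin j _ (hgmax j)
    have hgi : g i ∈ maxFace v (P i) := hv ▸ hg i
    rw [hv]
    exact mem_maxFace_of_le hgi hx.1 (by linarith)

/-- Under relatively general position all proper faces have an exact decomposition. -/
theorem RelativelyInGeneralPosition.dim_maxFace (hgen : RelativelyInGeneralPosition P)
    (hP : ∀ i, IsPolytope (P i)) {u : Module.Dual ℝ E}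
    (hne : maxFace u (∑ i, P i) ≠ ∑ i, P i) :
    dim (maxFace u (∑ i, P i)) = ∑ i, dim (maxFace u (P i)) := by
  obtain ⟨w, hw, hsub⟩ := (isPolytope_sum hP).exists_facet hne
  obtain ⟨G, hG, hdim⟩ := hgen _ hw
  simp only [hG.eq_maxFace hP] at hdim
  unfold dim at hdim ⊢
  rw [maxFace_sum, vectorSpan_sum fun i => (hP i).maxFace_nonempty _,
    finrank_iSup_eq_sum_iff] at hdim ⊢
  exact fun x hx => hdim x fun i =>
    vectorSpan_mono ℝ (maxFace_subset_of_sum_subset hP hsub i) (hx i)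

end Decomposition

/-! ### Weighted face counts -/

section Counting

variable {E : Type*} [NormedAddCommGroup E] [NormedSpace ℝ E]

theorem sum_mul_fVec {Q : Set E} (hQ : {F | IsFace F Q}.Finite) (d : ℕ) (a : ℕ → ℤ) :
    ∑ k ∈ Finset.range d, a k * fVec k Q =
      ∑ F ∈ hQ.toFinset.filter (fun F => dim F < d), a (dim F) := by
  classical
  rw [← Finset.sum_fiberwise_of_maps_to (g := dim) (t := Finset.range d)
    fun F hF => Finset.mem_range.2 (Finset.mem_filter.1 hF).2]
  refine Finset.sum_congr rfl fun k hk => ?_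
  have hset : {F : Set E | IsFace F Q ∧ dim F = k} =
      ↑((hQ.toFinset.filter fun F => dim F < d).filter fun F => dim F = k) := by
    ext F
    simp only [Finset.coe_filter, Finset.mem_filter, Set.Finite.mem_toFinset,
      Set.mem_ofPred_eq]
    constructor
    · rintro ⟨h, rfl⟩
      exact ⟨⟨h, Finset.mem_range.1 hk⟩, rfl⟩
    · rintro ⟨⟨h, -⟩, h'⟩
      exact ⟨h, h'⟩
  rw [fVec, hset, Set.ncard_coe_finset,
    Finset.sum_congr rfl fun F hF => by rw [(Finset.mem_filter.1 hF).2],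
    Finset.sum_const, nsmul_eq_mul, mul_comm]

variable [FiniteDimensional ℝ E]

theorem IsPolytope.isFace_self {P : Set E} (hP : IsPolytope P) : IsFace P P :=
  isFace_iff.2 ⟨hP.nonempty, 0, (maxFace_zero P).symm⟩

theorem IsPolytope.dim_lt_iff {P F : Set E} (hP : IsPolytope P) (hF : IsFace F P) :
    dim F < dim P ↔ F ≠ P := by
  obtain ⟨-, u, rfl⟩ := isFace_iff.1 hF
  exact ⟨fun h heq => by rw [heq] at h; exact h.false, hP.dim_maxFace_lt⟩

theorem IsPolytope.sum_range_dim {P : Set E} (hP : IsPolytope P) (a : ℕ → ℤ) :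
    ∑ k ∈ Finset.range (dim P), a k * fVec k P =
      ∑ F ∈ hP.finite_faces.toFinset, a (dim F) - a (dim P) := by
  classical
  have hmem : P ∈ hP.finite_faces.toFinset := hP.finite_faces.mem_toFinset.2 hP.isFace_self
  rw [sum_mul_fVec hP.finite_faces, ← Finset.add_sum_erase _ _ hmem, add_sub_cancel_left]
  refine Finset.sum_congr ?_ fun _ _ => rfl
  ext F
  rw [Finset.mem_filter, Finset.mem_erase, Set.Finite.mem_toFinset, and_comm]
  exact and_congr_left fun hF => hP.dim_lt_iff hF

theorem IsPolytope.sum_range_of_dim_lt {P : Set E} (hP : IsPolytope P) {d : ℕ} (hd : dim P < d)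
    (a : ℕ → ℤ) :
    ∑ k ∈ Finset.range d, a k * fVec k P = ∑ F ∈ hP.finite_faces.toFinset, a (dim F) := by
  rw [sum_mul_fVec hP.finite_faces, Finset.filter_true_of_mem]
  intro F hF
  obtain ⟨-, u, rfl⟩ := isFace_iff.1 (hP.finite_faces.mem_toFinset.1 hF)
  exact (dim_mono (maxFace_subset u P)).trans_lt hd

theorem sum_range_mul_fDelta {r : ℕ} {P : Fin r → Set E} (hP : ∀ i, IsPolytope (P i))
    (hgen : RelativelyInGeneralPosition P) :
    ∑ k ∈ Finset.range (dim (∑ i, P i)), (-1 : ℤ) ^ k * (k : ℤ) * fDelta k P =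
      (-1 : ℤ) ^ (dim (∑ i, P i) + 1) *
        ∑ i ∈ Finset.univ.filter (fun i => dim (P i) < dim (∑ i, P i)), (dim (P i) : ℤ) := by
  classical
  have hsum := isPolytope_sum hP
  set Q := ∑ i, P i with hQ
  set d := dim Q with hd
  set 𝓕 := hsum.finite_faces.toFinset with h𝓕
  have hQmem : Q ∈ 𝓕 := hsum.finite_faces.mem_toFinset.2 hsum.isFace_self
  -- The `i`-th summand of a face, read off from any functional defining it; the value `∅` on
  -- non-faces is never used.
  let φ : Fin r → Set E → Set E := fun i F =>
    if h : ∃ u, maxFace u Q = F then maxFace h.choose (P i) else ∅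
  have hφ : ∀ i u, φ i (maxFace u Q) = maxFace u (P i) := fun i u => by
    have h : ∃ u', maxFace u' Q = maxFace u Q := ⟨u, rfl⟩
    simp only [φ, dif_pos h]
    exact (maxFace_subset_of_sum_subset hP h.choose_spec.subset i).antisymm
      (maxFace_subset_of_sum_subset hP h.choose_spec.superset i)
  have hφQ : ∀ i, φ i Q = P i := fun i => by
    have := hφ i 0
    rwa [maxFace_zero, maxFace_zero] at this
  have hφface : ∀ i, ∀ F ∈ 𝓕, φ i F ∈ (hP i).finite_faces.toFinset := fun i F hF => by
    obtain ⟨-, u, rfl⟩ := isFace_iff.1 (hsum.finite_faces.mem_toFinset.1 hF)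
    rw [hφ, Set.Finite.mem_toFinset]
    exact isFace_iff.2 ⟨(hP i).maxFace_nonempty u, u, rfl⟩
  have hexact : ∀ F ∈ 𝓕.erase Q, (dim F : ℤ) = ∑ i, (dim (φ i F) : ℤ) := fun F hF => by
    obtain ⟨hne, hF⟩ := Finset.mem_erase.1 hF
    obtain ⟨-, u, rfl⟩ := isFace_iff.1 (hsum.finite_faces.mem_toFinset.1 hF)
    simp only [hφ]
    exact_mod_cast hgen.dim_maxFace hP hne
  have hfiber : ∀ i, ∑ F ∈ 𝓕, (-1 : ℤ) ^ dim F * dim (φ i F) =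
      ∑ G ∈ (hP i).finite_faces.toFinset, (-1 : ℤ) ^ dim G * dim G := fun i => by
    rw [← Finset.sum_fiberwise_of_maps_to (hφface i)]
    refine Finset.sum_congr rfl fun G hG => ?_
    rw [Finset.sum_congr rfl fun F hF => by rw [(Finset.mem_filter.1 hF).2], ← Finset.sum_mul,
      sum_faces_lying_over hP i (φ i) (hφ i) ((hP i).finite_faces.mem_toFinset.1 hG)]
    intro F
    rw [Finset.mem_filter, Set.Finite.mem_toFinset]
    rfl
  -- Exactness is available only for proper faces, so `Q` is removed from the fibrewise sum. As its
  -- `i`-th summand is `P i`, this costs `(-1) ^ d * dim (P i)`.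
  have hleft : ∑ k ∈ Finset.range d, (-1 : ℤ) ^ k * (k : ℤ) * fVec k Q =
      ∑ i, (∑ G ∈ (hP i).finite_faces.toFinset, (-1 : ℤ) ^ dim G * dim G -
        (-1) ^ d * dim (P i)) := by
    rw [hd, hsum.sum_range_dim fun k => (-1 : ℤ) ^ k * k, ← h𝓕,
      ← Finset.add_sum_erase _ _ hQmem, add_sub_cancel_left,
      Finset.sum_congr rfl fun F hF => by rw [hexact F hF, Finset.mul_sum], Finset.sum_comm]
    refine Finset.sum_congr rfl fun i _ => ?_
    rw [← hfiber, ← Finset.add_sum_erase _ _ hQmem, hφQ, add_sub_cancel_left]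
  have hdim : ∀ i, dim (P i) ≤ d := fun i => by
    rw [hd, hQ, dim, dim, vectorSpan_sum fun i => (hP i).nonempty]
    exact Submodule.finrank_mono (le_iSup (fun i => vectorSpan ℝ (P i)) i)
  have hright : ∀ i, ∑ k ∈ Finset.range d, (-1 : ℤ) ^ k * (k : ℤ) * fVec k (P i) =
      ∑ G ∈ (hP i).finite_faces.toFinset, (-1 : ℤ) ^ dim G * dim G -
        (-1) ^ d * dim (P i) + if dim (P i) < d then (-1) ^ d * (dim (P i) : ℤ) else 0 :=
    fun i => by
    split_ifs with h
    · rw [(hP i).sum_range_of_dim_lt h fun k => (-1 : ℤ) ^ k * k, sub_add_cancel]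
    · have heq : d = dim (P i) := le_antisymm (not_lt.1 h) (hdim i)
      rw [heq, (hP i).sum_range_dim fun k => (-1 : ℤ) ^ k * k, add_zero]
  simp only [fDelta, ← hQ, mul_sub, Finset.mul_sum, Finset.sum_sub_distrib]
  rw [hleft, Finset.sum_comm, Finset.sum_congr rfl fun i _ => hright i, Finset.sum_add_distrib,
    sub_add_cancel_left, ← Finset.sum_filter, ← Finset.sum_neg_distrib]
  refine Finset.sum_congr rfl fun i _ => ?_
  ring

end Counting

end MinkowskiFaces

theorem theorem4 {n r d : ℕ} (P : Fin r → Set (EuclideanSpace ℝ (Fin n)))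
    (hP : ∀ i, MinkowskiFaces.IsPolytope (P i))
    (hgen : MinkowskiFaces.RelativelyInGeneralPosition P)
    (hd : MinkowskiFaces.dim (∑ i, P i) = d) :
    ∑ k ∈ Finset.range d, (-1 : ℤ) ^ k * (k : ℤ) * MinkowskiFaces.fDelta k P =
      (-1 : ℤ) ^ (d + 1) *
        ∑ i ∈ Finset.univ.filter (fun i => MinkowskiFaces.dim (P i) < d),
          (MinkowskiFaces.dim (P i) : ℤ) := by
  subst hd
  exact MinkowskiFaces.sum_range_mul_fDelta hP hgen
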